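/- For a finite graph $G$ with adjacency matrix $A$ and eigenvalues $\lambda_1\ge\dots\ge\lambda_N$ (listed with multiplicity, $N=|V(G)|$), let the *inertia bound* be $\min\{|\{i:\lambda_i\ge 0\}|,\ |\{i:\lambda_i\le 0\}|\}$ and the *ratio bound* be $N/(1-\lambda_1/\lambda_N)$. Let $\alpha_t(G)$ be the maximum number of vertices of $G$ that are mutually at distance greater than $t$, so that $\alpha_1=\alpha$ is the independence number. A *$t$-sign polynomial* of $G$ is a real polynomial $s$ of degree at most $t$ with $\operatorname{tr}s(A)=\sum_i s(\lambda_i)=0$ which, among all such polynomials, minimizes $|\{i:s(\lambda_i)\ge 0\}|$; this number is the inertia-type bound given by $s$. A *$t$-minor polynomial* of $G$ is a real polynomial $f$ of degree at most $t$ with $f(\lambda_1)=1$ and $f(\lambda_i)\ge 0$ for every eigenvalue $\lambda_i\ne\lambda_1$ which, among all such polynomials, minimizes $\operatorname{tr}f(A)=\sum_i f(\lambda_i)$; this number is the ratio-type bound given by $f$. The polynomials $s$ and $f$ are *linearly related* if $s=c\left(\frac{N}{\operatorname{tr}f(A)}\,f-1\right)$ for some real $c\ne 0$. A connected regular graph $G$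 in which, for each $l\le t$, the number of closed walks of length $l$ rooted at a vertex does not depend on the vertex is a *$t$-Cvetković–Hoffman graph* if it has $t$-sign polynomials and $t$-minor polynomials, and every $t$-sign polynomial $s$ and every $t$-minor polynomial $f$ are linearly related and give the same bound. It is *tight* if this common bound equals $\alpha_t(G)$. The *Kneser graph* $K(n,k)$ has as vertices the $k$-subsets of $\{1,\dots,n\}$, two distinct vertices being adjacent if and only if they are disjoint. **Corollary.** Let $k\ge 1$ and $n>2k$. Then $K(n,k)$ is a tight $1$-Cvetković–Hoffman graph. Moreover, its inertia bound, its ratio bound and its independence number are all equal to $\binom{n-1}{k-1}$. -/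

import Mathlib

namespace SimpleGraph

/-- The Kneser graph `K(n,k)`: its vertices are the `k`-subsets of an `n`-set, and two (distinct)
vertices are adjacent when they are disjoint. The requirement of distinctness only matters for
`k = 0`. -/
def kneserGraph (n k : ℕ) : SimpleGraph {s : Finset (Fin n) // s.card = k} where
  Adj s t := s ≠ t ∧ Disjoint s.1 t.1
  symm := ⟨fun _ _ h => ⟨h.1.symm, h.2.symm⟩⟩
  loopless := ⟨fun _ h => h.1 rfl⟩

instance (n k : ℕ) : DecidableRel (kneserGraph n k).Adj :=
  fun s t => inferInstanceAs (Decidable (s ≠ t ∧ Disjoint s.1 t.1))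

/-- The `t`-independence number: the maximum number of vertices that are mutually at distance
greater than `t`. -/
noncomputable def tIndepNum {V : Type*} (G : SimpleGraph V) (t : ℕ) : ℕ :=
  sSup {m | ∃ s : Finset V, s.card = m ∧ (s : Set V).Pairwise fun u v => (t : ℕ∞) < G.edist u v}

section Spectrum

variable {V : Type*} [Fintype V] [DecidableEq V] (G : SimpleGraph V) [DecidableRel G.Adj]

/-- The eigenvalues of the adjacency matrix, listed with their multiplicities (the list is
indexed by the vertex set). -/
noncomputable def adjEigenvalue : V → ℝ := (G.isHermitian_adjMatrix (R := ℝ)).eigenvalues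

/-- The largest eigenvalue of the adjacency matrix. -/
noncomputable def maxAdjEigenvalue : ℝ := ⨆ i, G.adjEigenvalue i

/-- The least eigenvalue of the adjacency matrix. -/
noncomputable def minAdjEigenvalue : ℝ := ⨅ i, G.adjEigenvalue i

/-- The inertia bound `min {|{i : λ_i ≥ 0}|, |{i : λ_i ≤ 0}|}`. -/
noncomputable def inertiaBound : ℕ :=
  min (Finset.univ.filter fun i => 0 ≤ G.adjEigenvalue i).card
    (Finset.univ.filter fun i => G.adjEigenvalue i ≤ 0).card

/-- The ratio bound `|V| / (1 - λ_max / λ_min)`. -/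
noncomputable def ratioBound : ℝ :=
  (Fintype.card V : ℝ) / (1 - G.maxAdjEigenvalue / G.minAdjEigenvalue)

/-- The sum of `p(λ)` over all eigenvalues, with multiplicity; this is the trace of `p(A)`. -/
noncomputable def polyTrace (p : Polynomial ℝ) : ℝ := ∑ i, p.eval (G.adjEigenvalue i)

/-- The number of eigenvalues `λ`, with multiplicity, such that `s(λ) ≥ 0`. This is the
inertia-type bound given by a polynomial `s` with `tr s(A) = 0`. -/
noncomputable def signCount (s : Polynomial ℝ) : ℕ :=
  (Finset.univ.filter fun i => 0 ≤ s.eval (G.adjEigenvalue i)).card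

/-- Feasibility for the problem that defines the `t`-sign polynomials: degree at most `t` and
`tr s(A) = 0`. -/
def IsSignFeasible (t : ℕ) (s : Polynomial ℝ) : Prop :=
  s.natDegree ≤ t ∧ G.polyTrace s = 0

/-- A `t`-sign polynomial: among the polynomials of degree at most `t` with `tr s(A) = 0`, it
minimizes the number of eigenvalues at which it is non-negative. -/
def IsSignPoly (t : ℕ) (s : Polynomial ℝ) : Prop :=
  G.IsSignFeasible t s ∧ ∀ p, G.IsSignFeasible t p → G.signCount s ≤ G.signCount p

/-- Feasibility for the linear programme that defines the `t`-minor polynomials: degree at most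
`t`, value `1` at the largest eigenvalue, and non-negative values at all the others. -/
def IsMinorFeasible (t : ℕ) (f : Polynomial ℝ) : Prop :=
  f.natDegree ≤ t ∧ f.eval G.maxAdjEigenvalue = 1 ∧
    ∀ i, G.adjEigenvalue i ≠ G.maxAdjEigenvalue → 0 ≤ f.eval (G.adjEigenvalue i)

/-- A `t`-minor polynomial: a feasible polynomial that minimizes `tr f(A)`. This minimum is the
ratio-type bound that it gives. -/
def IsMinorPoly (t : ℕ) (f : Polynomial ℝ) : Prop :=
  G.IsMinorFeasible t f ∧ ∀ p, G.IsMinorFeasible t p → G.polyTrace f ≤ G.polyTrace p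

/-- `s` and `f` are linearly related: up to a non-zero scalar factor (positive or negative),
`s = (|V| / tr f(A)) f - 1`. -/
def LinearlyRelated (s f : Polynomial ℝ) : Prop :=
  ∃ c : ℝ, c ≠ 0 ∧
    s = Polynomial.C c * (Polynomial.C ((Fintype.card V : ℝ) / G.polyTrace f) * f - 1)

/-- The number of closed walks of length `l ≤ t` rooted at a vertex depends only on `l`. -/
def IsPartiallyWalkRegular (t : ℕ) : Prop :=
  ∀ l ≤ t, ∀ u v : V, ((G.adjMatrix ℕ) ^ l) u u = ((G.adjMatrix ℕ) ^ l) v v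

/-- A `t`-Cvetković–Hoffman graph: a connected regular `t`-partially walk-regular graph whose
`t`-sign polynomials and `t`-minor polynomials exist, are linearly related, and give the same
bound on the `t`-independence number. -/
structure IsCvetkovicHoffman (t : ℕ) : Prop where
  connected : G.Connected
  regular : ∃ r, G.IsRegularOfDegree r
  walkRegular : G.IsPartiallyWalkRegular t
  exists_sign : ∃ s, G.IsSignPoly t s
  exists_minor : ∃ f, G.IsMinorPoly t f
  related : ∀ s f, G.IsSignPoly t s → G.IsMinorPoly t f → G.LinearlyRelated s f
  bounds_eq : ∀ s f, G.IsSignPoly t s → G.IsMinorPoly t f → (G.signCount s : ℝ) = G.polyTrace f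

/-- A tight `t`-Cvetković–Hoffman graph: the common value of the two bounds is the
`t`-independence number. -/
structure IsTightCvetkovicHoffman (t : ℕ) : Prop extends G.IsCvetkovicHoffman t where
  sign_tight : ∀ s, G.IsSignPoly t s → G.signCount s = G.tIndepNum t
  minor_tight : ∀ f, G.IsMinorPoly t f → G.polyTrace f = (G.tIndepNum t : ℝ)

end Spectrum

end SimpleGraph

/-! Since `A` has trace zero, a `1`-sign polynomial is a multiple of `X`, and the `1`-minor
polynomial is the line through `(λ_max, 1)` and `(λ_min, 0)`. Thus `isTightCvetkovicHoffman_one`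
reduces tightness to the equality of inertia bound, ratio bound and independence number.

The star of a point is independent, so `C(n-1,k-1) ≤ α ≤` inertia bound. The reverse inequality
needs no eigenvalue multiplicities. If `A x` vanishes on the star, then `(-1)^k xᵀAx ≥ 0`
(`kneserGraph_quadraticForm_nonneg`): the form only sees the part of `x` off the star, where
inclusion–exclusion shows that `A` acts as `(-1)^k`. These conditions number `C(n-1,k-1)`, so
`card_le_of_nonneg_on_ker` bounds the eigenvalues of sign `-(-1)^k`; no eigenvalue is zero, so this
bounds the inertia bound.

For the ratio bound, `kneserGraph_eigenvalue` restricts the possible eigenvalues, and explicit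
eigenvectors attain the two extremes. -/

namespace Matrix.IsHermitian

/-! ### Eigencoordinates and an inertia estimate for symmetric matrices. -/

variable {V : Type*} [Fintype V] [DecidableEq V] {A : Matrix V V ℝ} (hA : A.IsHermitian)

/-- The coordinate of a real vector with respect to the `i`-th vector of the eigenvector basis. -/
noncomputable def eigenCoord (i : V) : (V → ℝ) →ₗ[ℝ] ℝ :=
  dotProductBilin ℝ ℝ (hA.eigenvectorBasis i).ofLp

lemma eigenCoord_apply (i : V) (x : V → ℝ) :
    hA.eigenCoord i x = (hA.eigenvectorBasis i).ofLp ⬝ᵥ x := rfl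

lemma sum_eigenCoord_mul (x y : V → ℝ) :
    ∑ i, hA.eigenCoord i x * hA.eigenCoord i y = x ⬝ᵥ y := by
  have h := hA.eigenvectorBasis.sum_inner_mul_inner (WithLp.toLp 2 x) (WithLp.toLp 2 y)
  simpa [EuclideanSpace.inner_eq_star_dotProduct, eigenCoord_apply, dotProduct_comm] using h

lemma eigenCoord_mulVec (i : V) (x : V → ℝ) :
    hA.eigenCoord i (A *ᵥ x) = hA.eigenvalues i * hA.eigenCoord i x := by
  have hT : Aᵀ = A := by simpa [IsHermitian, conjTranspose_eq_transpose_of_trivial] using hA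
  rw [eigenCoord_apply, eigenCoord_apply, dotProduct_mulVec, ← mulVec_transpose, hT,
    hA.mulVec_eigenvectorBasis, smul_dotProduct, smul_eq_mul]

lemma dotProduct_mulVec_self (x : V → ℝ) :
    x ⬝ᵥ A *ᵥ x = ∑ i, hA.eigenvalues i * hA.eigenCoord i x ^ 2 := by
  rw [← hA.sum_eigenCoord_mul]
  refine Finset.sum_congr rfl fun i _ => ?_
  rw [eigenCoord_mulVec]
  ring

lemma eq_zero_of_eigenCoord_eq_zero {x : V → ℝ} (h : ∀ i, hA.eigenCoord i x = 0) : x = 0 := by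
  rw [← dotProduct_self_eq_zero, ← hA.sum_eigenCoord_mul]
  simp [h]

/-- If the quadratic form of `ε A` is non-negative on the kernel of a linear map, then the
number of eigenvalues of `A` of sign opposite to `ε` is at most the dimension of the codomain. -/
theorem card_le_of_nonneg_on_ker {W : Type*} [Fintype W] (L : (V → ℝ) →ₗ[ℝ] (W → ℝ)) (ε : ℝ)
    (P : Finset V) (hP : ∀ i ∈ P, ε * hA.eigenvalues i < 0)
    (hL : ∀ x, L x = 0 → 0 ≤ ε * (x ⬝ᵥ A *ᵥ x)) : P.card ≤ Fintype.card W := by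
  let Φ : (V → ℝ) →ₗ[ℝ] (W → ℝ) × ({i // i ∉ P} → ℝ) :=
    L.prod (LinearMap.pi fun i => hA.eigenCoord i.1)
  -- On the kernel of `Φ` only coordinates in `P` survive, so the form is a sum of non-positive
  -- terms; as `hL` makes it non-negative, every term vanishes.
  have hΦ : Function.Injective Φ := by
    rw [← LinearMap.ker_eq_bot, LinearMap.ker_eq_bot']
    intro x hx
    obtain ⟨h1, h2⟩ : L x = 0 ∧ (fun i : {i // i ∉ P} => hA.eigenCoord i.1 x) = 0 :=
      Prod.ext_iff.1 hx
    have hout : ∀ i ∉ P, hA.eigenCoord i x = 0 := fun i hi => congrFun h2 ⟨i, hi⟩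
    have hq := hL x h1
    rw [hA.dotProduct_mulVec_self, Finset.mul_sum] at hq
    have hterm : ∀ i ∈ Finset.univ,
        ε * (hA.eigenvalues i * hA.eigenCoord i x ^ 2) ≤ 0 := fun i _ => by
      by_cases hi : i ∈ P
      · rw [← mul_assoc]
        exact mul_nonpos_of_nonpos_of_nonneg (hP i hi).le (sq_nonneg _)
      · simp [hout i hi]
    have hz := (Finset.sum_eq_zero_iff_of_nonpos hterm).1
      (le_antisymm (Finset.sum_nonpos hterm) hq)
    refine hA.eq_zero_of_eigenCoord_eq_zero fun i => ?_
    by_cases hi : i ∈ P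
    · have := hz i (Finset.mem_univ i)
      rw [← mul_assoc] at this
      simpa using (mul_eq_zero.1 this).resolve_left (hP i hi).ne
    · exact hout i hi
  have h := LinearMap.finrank_le_finrank_of_injective hΦ
  have hc : Fintype.card {i // i ∉ P} = Fintype.card V - P.card := by
    rw [Fintype.card_subtype_compl]; simp
  rw [Module.finrank_prod, Module.finrank_fintype_fun_eq_card, Module.finrank_fintype_fun_eq_card,
    Module.finrank_fintype_fun_eq_card, hc] at h
  have := P.card_le_univ
  omega

lemma exists_eigenvalues_eq {x : V → ℝ} (hx : x ≠ 0) {μ : ℝ} (h : A *ᵥ x = μ • x) :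
    ∃ i, hA.eigenvalues i = μ := by
  by_contra! hne
  refine hx (hA.eq_zero_of_eigenCoord_eq_zero fun i => ?_)
  have := hA.eigenCoord_mulVec i x
  rw [h, map_smul, smul_eq_mul] at this
  exact (mul_eq_mul_right_iff.1 this).resolve_left (hne i).symm

lemma exists_eigenvector (i : V) : ∃ x : V → ℝ, x ≠ 0 ∧ A *ᵥ x = hA.eigenvalues i • x :=
  ⟨_, (WithLp.ofLp_eq_zero 2).ne.2 (hA.eigenvectorBasis.orthonormal.ne_zero i),
    hA.mulVec_eigenvectorBasis i⟩

end Matrix.IsHermitian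

namespace SimpleGraph

open Matrix Polynomial

variable {V : Type*} [Fintype V] [DecidableEq V] (G : SimpleGraph V) [DecidableRel G.Adj]

/-! ### The inertia bound and general facts for `t = 1`. -/

lemma dotProduct_adjMatrix_mulVec_eq_zero {s : Finset V} (hs : G.IsIndepSet s) {x : V → ℝ}
    (hx : ∀ v ∉ s, x v = 0) : x ⬝ᵥ G.adjMatrix ℝ *ᵥ x = 0 := by
  refine Finset.sum_eq_zero fun v _ => ?_
  by_cases hv : v ∈ s
  · rw [adjMatrix_mulVec_apply, Finset.sum_eq_zero, mul_zero]
    intro u hu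
    rw [mem_neighborFinset] at hu
    exact hx u fun hus => hs hv hus hu.ne hu
  · rw [hx v hv, zero_mul]

/-- The **inertia bound** of Cvetković. -/
theorem IsIndepSet.card_le_inertiaBound {s : Finset V} (hs : G.IsIndepSet s) :
    s.card ≤ G.inertiaBound := by
  -- The form is zero on vectors supported on `s`, so the dimension count applies to both signs of
  -- `ε`.
  have key : ∀ (ε : ℝ) (P : Finset V), (∀ i ∈ P, ε * G.adjEigenvalue i < 0) →
      P.card ≤ Fintype.card {v // v ∉ s} := fun ε P hP => by
    refine (G.isHermitian_adjMatrix (R := ℝ)).card_le_of_nonneg_on_ker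
      (LinearMap.funLeft ℝ ℝ Subtype.val) ε P hP fun x hx => ?_
    rw [G.dotProduct_adjMatrix_mulVec_eq_zero hs fun v hv => congrFun hx ⟨v, hv⟩, mul_zero]
  have hc : Fintype.card {v // v ∉ s} = Fintype.card V - s.card := by
    rw [Fintype.card_subtype_compl]; simp
  have h1 := key 1 (Finset.univ.filter fun i => ¬ 0 ≤ G.adjEigenvalue i) (by simp)
  have h2 := key (-1) (Finset.univ.filter fun i => ¬ G.adjEigenvalue i ≤ 0) (by simp)
  have e1 := Finset.card_filter_add_card_filter_not (s := Finset.univ)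
    (fun i => 0 ≤ G.adjEigenvalue i)
  have e2 := Finset.card_filter_add_card_filter_not (s := Finset.univ)
    (fun i => G.adjEigenvalue i ≤ 0)
  have := s.card_le_univ
  rw [Finset.card_univ] at e1 e2
  refine le_min ?_ ?_ <;> omega

omit [Fintype V] [DecidableEq V] [DecidableRel G.Adj] in
lemma tIndepNum_one : G.tIndepNum 1 = G.indepNum := by
  unfold tIndepNum indepNum
  congr 1
  ext m
  refine exists_congr fun s => ?_
  rw [isNIndepSet_iff, and_comm]
  refine and_congr_left fun _ => ?_
  have : ∀ u v, u ≠ v → ((((1 : ℕ) : ℕ∞) < G.edist u v) ↔ ¬ G.Adj u v) := fun u v huv => by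
    rw [← not_le, Nat.cast_one, edist_le_one_iff_adj_or_eq]
    simp [huv]
  exact ⟨fun h u hu v hv huv => (this u v huv).1 (h hu hv huv),
    fun h u hu v hv huv => (this u v huv).2 (h hu hv huv)⟩

lemma isPartiallyWalkRegular_one : G.IsPartiallyWalkRegular 1 := by
  intro l hl u v
  interval_cases l <;> simp

lemma sum_adjEigenvalue : ∑ i, G.adjEigenvalue i = 0 := by
  have h := (G.isHermitian_adjMatrix (R := ℝ)).trace_eq_sum_eigenvalues
  rw [trace_adjMatrix] at h
  exact h.symm

lemma polyTrace_linear (a b : ℝ) : G.polyTrace (C a * X + C b) = Fintype.card V * b := by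
  simp [polyTrace, Finset.sum_add_distrib, ← Finset.mul_sum, sum_adjEigenvalue]

lemma exists_eigenvector_adjEigenvalue (i : V) :
    ∃ x : V → ℝ, x ≠ 0 ∧ G.adjMatrix ℝ *ᵥ x = G.adjEigenvalue i • x :=
  (G.isHermitian_adjMatrix (R := ℝ)).exists_eigenvector i

lemma exists_adjEigenvalue_eq {x : V → ℝ} (hx : x ≠ 0) {μ : ℝ}
    (h : G.adjMatrix ℝ *ᵥ x = μ • x) : ∃ i, G.adjEigenvalue i = μ :=
  (G.isHermitian_adjMatrix (R := ℝ)).exists_eigenvalues_eq hx h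

lemma adjEigenvalue_le_max (i : V) : G.adjEigenvalue i ≤ G.maxAdjEigenvalue :=
  le_ciSup (Set.finite_range _).bddAbove i

lemma min_le_adjEigenvalue (i : V) : G.minAdjEigenvalue ≤ G.adjEigenvalue i :=
  ciInf_le (Set.finite_range _).bddBelow i

/-! ### Sign polynomials of degree at most one. -/

section Sign

lemma isSignFeasible_one_iff [Nonempty V] {s : ℝ[X]} :
    G.IsSignFeasible 1 s ↔ ∃ a : ℝ, s = C a * X := by
  constructor
  · rintro ⟨hd, ht⟩
    obtain ⟨a, b, rfl⟩ := exists_eq_X_add_C_of_natDegree_le_one hd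
    rw [polyTrace_linear] at ht
    have hb : b = 0 := (mul_eq_zero.1 ht).resolve_left (by simp)
    exact ⟨a, by simp [hb]⟩
  · rintro ⟨a, rfl⟩
    exact ⟨natDegree_C_mul_le a X |>.trans natDegree_X_le, by simpa using G.polyTrace_linear a 0⟩

lemma signCount_of_pos {a : ℝ} (ha : 0 < a) :
    G.signCount (C a * X) = (Finset.univ.filter fun i => 0 ≤ G.adjEigenvalue i).card := by
  simp [signCount, ha]

lemma signCount_of_neg {a : ℝ} (ha : a < 0) :
    G.signCount (C a * X) = (Finset.univ.filter fun i => G.adjEigenvalue i ≤ 0).card := by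
  refine congrArg Finset.card (Finset.filter_congr fun i _ => ?_)
  rw [eval_mul, eval_C, eval_X]
  exact ⟨fun h => nonpos_of_mul_nonneg_right h ha, mul_nonneg_of_nonpos_of_nonpos ha.le⟩

lemma signCount_zero : G.signCount (C 0 * X) = Fintype.card V := by
  simp [signCount]

lemma inertiaBound_le_signCount (a : ℝ) : G.inertiaBound ≤ G.signCount (C a * X) := by
  rcases lt_trichotomy a 0 with ha | rfl | ha
  · rw [signCount_of_neg G ha]; exact min_le_right _ _
  · rw [signCount_zero]; exact (min_le_left _ _).trans (Finset.card_le_univ _)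
  · rw [signCount_of_pos G ha]; exact min_le_left _ _

lemma exists_signCount_eq_inertiaBound : ∃ a : ℝ, G.signCount (C a * X) = G.inertiaBound := by
  rcases min_choice (Finset.univ.filter fun i => 0 ≤ G.adjEigenvalue i).card
    (Finset.univ.filter fun i => G.adjEigenvalue i ≤ 0).card with h | h
  · exact ⟨1, by rw [signCount_of_pos G one_pos, inertiaBound, h]⟩
  · exact ⟨-1, by rw [signCount_of_neg G (by norm_num), inertiaBound, h]⟩

lemma isSignPoly_one_iff [Nonempty V] {s : ℝ[X]} :
    G.IsSignPoly 1 s ↔ ∃ a : ℝ, s = C a * X ∧ G.signCount (C a * X) = G.inertiaBound := by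
  constructor
  · rintro ⟨hs, hmin⟩
    obtain ⟨a, rfl⟩ := G.isSignFeasible_one_iff.1 hs
    obtain ⟨b, hb⟩ := G.exists_signCount_eq_inertiaBound
    exact ⟨a, rfl, le_antisymm (hb ▸ hmin _ (G.isSignFeasible_one_iff.2 ⟨b, rfl⟩))
      (G.inertiaBound_le_signCount a)⟩
  · rintro ⟨a, rfl, ha⟩
    refine ⟨G.isSignFeasible_one_iff.2 ⟨a, rfl⟩, fun p hp => ?_⟩
    obtain ⟨b, rfl⟩ := G.isSignFeasible_one_iff.1 hp
    exact ha ▸ G.inertiaBound_le_signCount b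

end Sign

/-! ### Minor polynomials of degree at most one. -/

section Minor

variable (hmax : 0 < G.maxAdjEigenvalue) (hmin : G.minAdjEigenvalue < 0)
include hmax hmin

/-- The `1`-minor polynomial is unique. -/
lemma isMinorPoly_one_iff [Nonempty V] {f : ℝ[X]} :
    G.IsMinorPoly 1 f ↔
      f = C (G.maxAdjEigenvalue - G.minAdjEigenvalue)⁻¹ * X +
        C (-G.minAdjEigenvalue / (G.maxAdjEigenvalue - G.minAdjEigenvalue)) := by
  set M := G.maxAdjEigenvalue with hM
  set m := G.minAdjEigenvalue with hm
  have hpos : 0 < M - m := by linarith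
  obtain ⟨i, hi⟩ : ∃ i, G.adjEigenvalue i = m := exists_eq_ciInf_of_finite
  have hN : (0 : ℝ) < Fintype.card V := by exact_mod_cast Fintype.card_pos
  have hfeas : G.IsMinorFeasible 1 (C (M - m)⁻¹ * X + C (-m / (M - m))) := by
    refine ⟨natDegree_linear_le, ?_, fun j _ => ?_⟩
    · simp only [eval_add, eval_mul, eval_C, eval_X, ← hM]
      field_simp
      ring
    · simp only [eval_add, eval_mul, eval_C, eval_X]
      rw [inv_mul_eq_div, ← add_div]
      exact div_nonneg (by linarith [G.min_le_adjEigenvalue j]) hpos.le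
  -- The trace is `N * b`. Eliminating `a` from `a M + b = 1` and `a m + b ≥ 0` bounds `b` below,
  -- using `M > 0`.
  have hbd : ∀ a b : ℝ, G.IsMinorFeasible 1 (C a * X + C b) →
      a * M + b = 1 ∧ -m / (M - m) ≤ b := by
    rintro a b ⟨-, h1, h2⟩
    have h3 := h2 i (by rw [hi]; exact (by linarith : m < M).ne)
    simp only [eval_add, eval_mul, eval_C, eval_X, ← hM, hi] at h1 h3
    refine ⟨h1, ?_⟩
    rw [div_le_iff₀ hpos]
    nlinarith
  constructor
  · rintro ⟨hf, hopt⟩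
    obtain ⟨a, b, rfl⟩ := exists_eq_X_add_C_of_natDegree_le_one hf.1
    obtain ⟨h1, h2⟩ := hbd a b hf
    have h3 := hopt _ hfeas
    rw [polyTrace_linear, polyTrace_linear] at h3
    have hb : b = -m / (M - m) := le_antisymm (le_of_mul_le_mul_left h3 hN) h2
    have ha : a = (M - m)⁻¹ := by
      have : a * M = (M - m)⁻¹ * M := by
        rw [eq_sub_of_add_eq h1, hb]
        field_simp
        ring
      exact mul_right_cancel₀ hmax.ne' this
    rw [ha, hb]
  · rintro rfl
    refine ⟨hfeas, fun p hp => ?_⟩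
    obtain ⟨a, b, rfl⟩ := exists_eq_X_add_C_of_natDegree_le_one hp.1
    rw [polyTrace_linear, polyTrace_linear]
    exact mul_le_mul_of_nonneg_left (hbd a b hp).2 hN.le

lemma polyTrace_minorPoly_one :
    G.polyTrace (C (G.maxAdjEigenvalue - G.minAdjEigenvalue)⁻¹ * X +
        C (-G.minAdjEigenvalue / (G.maxAdjEigenvalue - G.minAdjEigenvalue))) = G.ratioBound := by
  rw [polyTrace_linear, ratioBound]
  have h1 : G.maxAdjEigenvalue - G.minAdjEigenvalue ≠ 0 := by linarith
  have h2 : G.minAdjEigenvalue - G.maxAdjEigenvalue ≠ 0 := by linarith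
  have h3 : 1 - G.maxAdjEigenvalue / G.minAdjEigenvalue ≠ 0 := by
    rw [one_sub_div hmin.ne]
    exact div_ne_zero h2 hmin.ne
  rw [one_sub_div hmin.ne]
  have := hmin.ne
  field_simp
  ring

/-- A connected regular graph with independence number, inertia bound and ratio bound equal, and
smaller than the number of vertices, is a tight `1`-Cvetković–Hoffman graph. -/
theorem isTightCvetkovicHoffman_one (hconn : G.Connected) (hreg : ∃ r, G.IsRegularOfDegree r)
    (hlt : G.inertiaBound < Fintype.card V) (hinertia : G.inertiaBound = G.indepNum)
    (hratio : G.ratioBound = G.indepNum) : G.IsTightCvetkovicHoffman 1 := by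
  have := hconn.nonempty
  have hsign : ∀ s, G.IsSignPoly 1 s → G.signCount s = G.indepNum := fun s hs => by
    obtain ⟨a, rfl, h⟩ := G.isSignPoly_one_iff.1 hs
    rw [h, hinertia]
  have hminor : ∀ f, G.IsMinorPoly 1 f → G.polyTrace f = G.indepNum := fun f hf => by
    rw [(G.isMinorPoly_one_iff hmax hmin).1 hf, polyTrace_minorPoly_one G hmax hmin, hratio]
  refine ⟨⟨hconn, hreg, G.isPartiallyWalkRegular_one, ?_, ?_, ?_, ?_⟩, ?_, ?_⟩
  · obtain ⟨a, ha⟩ := G.exists_signCount_eq_inertiaBound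
    exact ⟨_, G.isSignPoly_one_iff.2 ⟨a, rfl, ha⟩⟩
  · exact ⟨_, (G.isMinorPoly_one_iff hmax hmin).2 rfl⟩
  · intro s f hs hf
    obtain ⟨a, rfl, h⟩ := G.isSignPoly_one_iff.1 hs
    -- The zero polynomial is feasible but counts every eigenvalue; `hlt` rules it out.
    have ha : a ≠ 0 := by
      rintro rfl
      rw [signCount_zero] at h
      omega
    rw [(G.isMinorPoly_one_iff hmax hmin).1 hf]
    have hN : (Fintype.card V : ℝ) ≠ 0 := by simp
    have h1 : G.maxAdjEigenvalue - G.minAdjEigenvalue ≠ 0 := by linarith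
    have hm := hmin.ne
    -- With `f = (X - m) / (M - m)` and `tr f(A) = -N m / (M - m)`, one gets `(N / tr f(A)) f - 1 =
    -- -X / m`.
    refine ⟨-a * G.minAdjEigenvalue, by simp [ha, hm], ?_⟩
    rw [polyTrace_linear]
    refine Polynomial.funext fun x => ?_
    simp only [eval_add, eval_mul, eval_C, eval_X, eval_sub, eval_one]
    field_simp
    ring
  · intro s f hs hf
    rw [hsign s hs, hminor f hf]
  · intro s hs
    rw [hsign s hs, tIndepNum_one]
  · intro f hf
    rw [hminor f hf, tIndepNum_one]

end Minor

end SimpleGraph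
namespace SimpleGraph

/-! ### Inclusion–exclusion and double counting for functions on `k`-subsets. -/

section SubsetSums

open Finset

variable {α : Type*} [DecidableEq α]

/-- The alternating sum runs over the subsets of `J ∩ S`, so it vanishes unless that set is empty.
-/
lemma sum_powerset_neg_one_pow_subset (J S : Finset α) :
    ∑ I ∈ J.powerset, (if I ⊆ S then (-1 : ℝ) ^ #I else 0) = if Disjoint J S then 1 else 0 := by
  have h : J.powerset.filter (· ⊆ S) = (J ∩ S).powerset := by
    ext I
    rw [mem_filter, mem_powerset, mem_powerset, subset_inter_iff]
  rw [← sum_filter, h]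
  have := congrArg (Int.cast : ℤ → ℝ) (sum_powerset_neg_one_pow_card (x := J ∩ S))
  push_cast at this
  rw [this]
  simp [disjoint_iff_inter_eq_empty]

lemma sum_powerset_neg_one_pow_disjoint (J S : Finset α) :
    ∑ I ∈ J.powerset, (if Disjoint I S then (-1 : ℝ) ^ #I else 0) = if J ⊆ S then 1 else 0 := by
  have h : J.powerset.filter (Disjoint · S) = (J \ S).powerset := by
    ext I
    simp [subset_sdiff]
  rw [← sum_filter, h]
  have := congrArg (Int.cast : ℤ → ℝ) (sum_powerset_neg_one_pow_card (x := J \ S))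
  push_cast at this
  rw [this]
  simp [sdiff_eq_empty_iff_subset]

lemma card_powersetCard_filter_subset_disjoint {X J : Finset α} (S : Finset α) {m : ℕ}
    (hJ : J ⊆ X) (hm : #J ≤ m) :
    #((X.powersetCard m).filter fun R => J ⊆ R ∧ Disjoint R S) =
      if Disjoint J S then (#(X \ S) - #J).choose (m - #J) else 0 := by
  split_ifs with h
  · rw [← card_filter_powersetCard_subset J (X \ S) m (subset_sdiff.2 ⟨hJ, h⟩) hm]
    congr 1
    ext R
    simp only [mem_filter, mem_powersetCard, subset_sdiff]
    tauto
  · rw [card_eq_zero, filter_eq_empty_iff]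
    exact fun R _ hR => h (hR.2.mono_left hR.1)

variable [Fintype α] {k : ℕ}

/-- The sum of a function on `k`-subsets over those containing `J`. -/
def supSum (y : {s : Finset α // #s = k} → ℝ) (J : Finset α) : ℝ :=
  ∑ S, if J ⊆ S.1 then y S else 0

/-- The sum of a function on `k`-subsets over those disjoint from `J`. -/
def disjSum (y : {s : Finset α // #s = k} → ℝ) (J : Finset α) : ℝ :=
  ∑ S, if Disjoint J S.1 then y S else 0

lemma disjSum_eq_sum_supSum (y : {s : Finset α // #s = k} → ℝ) (J : Finset α) :
    disjSum y J = ∑ I ∈ J.powerset, (-1) ^ #I * supSum y I := by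
  simp_rw [disjSum, supSum, mul_sum]
  rw [sum_comm]
  refine sum_congr rfl fun S _ => ?_
  have := congrArg (· * y S) (sum_powerset_neg_one_pow_subset J S.1)
  simpa [sum_mul, ite_mul, mul_ite] using this.symm

lemma supSum_eq_sum_disjSum (y : {s : Finset α // #s = k} → ℝ) (J : Finset α) :
    supSum y J = ∑ I ∈ J.powerset, (-1) ^ #I * disjSum y I := by
  simp_rw [disjSum, supSum, mul_sum]
  rw [sum_comm]
  refine sum_congr rfl fun S _ => ?_
  have := congrArg (· * y S) (sum_powerset_neg_one_pow_disjoint J S.1)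
  simpa [sum_mul, ite_mul, mul_ite] using this.symm

lemma supSum_self (y : {s : Finset α // #s = k} → ℝ) (S : {s : Finset α // #s = k}) :
    supSum y S.1 = y S := by
  rw [supSum, sum_eq_single S]
  · simp
  · intro T _ hT
    rw [if_neg]
    exact fun h => hT (Subtype.ext (eq_of_subset_of_card_le h (by rw [S.2, T.2])).symm)
  · simp

/-- Double counting: for `S` disjoint from `J`, the set `R \ J` ranges over the `(m - #J)`-subsets
of `X \ S \ J`. A constant `#(X \ S)` is needed only on the support of `y`, which later allows `X`
to omit a point. -/
lemma sum_disjSum_of_subset (y : {s : Finset α // #s = k} → ℝ) {X J : Finset α} {m c : ℕ}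
    (hJ : J ⊆ X) (hm : #J ≤ m) (hc : ∀ S, y S ≠ 0 → #(X \ S.1) = c) :
    ∑ R ∈ X.powersetCard m, (if J ⊆ R then disjSum y R else 0) =
      (c - #J).choose (m - #J) * disjSum y J := by
  have h : ∀ R, (if J ⊆ R then disjSum y R else 0) =
      ∑ S, if J ⊆ R ∧ Disjoint R S.1 then y S else 0 := fun R => by
    split_ifs with h <;> simp [disjSum, h]
  simp_rw [h]
  rw [sum_comm, disjSum, mul_sum]
  refine sum_congr rfl fun S _ => ?_
  rw [← sum_filter, sum_const, card_powersetCard_filter_subset_disjoint _ hJ hm, nsmul_eq_mul]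
  by_cases hS : y S = 0
  · simp [hS]
  · rw [hc S hS]
    split_ifs <;> simp

end SubsetSums

/-- By symmetry both coefficients have lower index `a - b`, and the upper index only shrinks. -/
lemma choose_sub_sub_le_choose {a b : ℕ} (j : ℕ) (hj : j ≤ b) (hab : b ≤ a) :
    (a - j).choose (b - j) ≤ a.choose b := by
  rw [← Nat.choose_symm hab, ← Nat.choose_symm (by omega : b - j ≤ a - j),
    show a - j - (b - j) = a - b by omega]
  exact Nat.choose_le_choose _ (Nat.sub_le _ _)

/-! ### Stars and spectrum of the Kneser graph. -/

section Kneser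

open Matrix

variable {n k : ℕ}

lemma kneserGraph_adj_iff (hk : 1 ≤ k) {S T : {s : Finset (Fin n) // s.card = k}} :
    (kneserGraph n k).Adj S T ↔ Disjoint S.1 T.1 := by
  refine ⟨fun h => h.2, fun h => ⟨?_, h⟩⟩
  rintro rfl
  have := S.2
  rw [disjoint_self, Finset.bot_eq_empty] at h
  simp [h] at this
  omega

lemma kneserGraph_mulVec_apply (hk : 1 ≤ k) (y : {s : Finset (Fin n) // s.card = k} → ℝ)
    (S : {s : Finset (Fin n) // s.card = k}) :
    ((kneserGraph n k).adjMatrix ℝ *ᵥ y) S = disjSum y S.1 := by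
  simp [mulVec, dotProduct, adjMatrix_apply, kneserGraph_adj_iff hk, disjSum]

lemma card_kneserGraph_vertex : Fintype.card {s : Finset (Fin n) // s.card = k} = n.choose k := by
  simp

lemma card_kneserGraph_filter (p : Finset (Fin n) → Prop) [DecidablePred p] :
    (Finset.univ.filter fun S : {s : Finset (Fin n) // s.card = k} => p S.1).card =
      ((Finset.univ.powersetCard k).filter p).card := by
  refine Finset.card_bij (fun S _ => S.1) (fun S hS => ?_) (fun _ _ _ _ h => Subtype.ext h)
    fun R hR => ?_
  · simpa [S.2] using hS
  · simp only [Finset.mem_filter, Finset.mem_powersetCard] at hR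
    exact ⟨⟨R, hR.1.2⟩, by simpa using hR.2, rfl⟩

/-- The `k`-subsets that contain `a`. -/
def kneserStar (n k : ℕ) (a : Fin n) : Finset {s : Finset (Fin n) // s.card = k} :=
  Finset.univ.filter fun S => a ∈ S.1

lemma card_kneserStar (hk : 1 ≤ k) (a : Fin n) :
    (kneserStar n k a).card = (n - 1).choose (k - 1) := by
  have := Finset.card_filter_powersetCard_subset {a} Finset.univ k (Finset.subset_univ _) (by simpa)
  rw [kneserStar, card_kneserGraph_filter fun S => a ∈ S]
  simpa using this

lemma isIndepSet_kneserStar (a : Fin n) : (kneserGraph n k).IsIndepSet (kneserStar n k a) := by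
  intro S hS T hT _ h
  simp only [kneserStar, Finset.coe_filter, Finset.mem_univ, true_and, Set.mem_ofPred_eq] at hS hT
  exact Finset.disjoint_left.1 h.2 hS hT

lemma kneserGraph_isRegularOfDegree (hk : 1 ≤ k) :
    (kneserGraph n k).IsRegularOfDegree ((n - k).choose k) := by
  intro S
  have h : (kneserGraph n k).neighborFinset S = Finset.univ.filter fun T => Disjoint T.1 S.1 := by
    ext T
    simp [kneserGraph_adj_iff hk, disjoint_comm]
  have := card_powersetCard_filter_subset_disjoint (X := Finset.univ) (J := ∅) (m := k) S.1
    (Finset.empty_subset _) (by simp)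
  rw [← card_neighborFinset_eq_degree, h, card_kneserGraph_filter fun T => Disjoint T S.1]
  simpa [Finset.card_univ_sdiff, S.2] using this

lemma supSum_kneserGraph_mulVec (hk : 1 ≤ k) (y : {s : Finset (Fin n) // s.card = k} → ℝ)
    {J : Finset (Fin n)} (hJ : J.card ≤ k) :
    supSum ((kneserGraph n k).adjMatrix ℝ *ᵥ y) J =
      (n - k - J.card).choose (k - J.card) * disjSum y J := by
  rw [← sum_disjSum_of_subset y (Finset.subset_univ J) hJ (c := n - k)
    fun S _ => by rw [Finset.card_univ_sdiff, S.2, Fintype.card_fin], supSum,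
    Finset.sum_subtype (p := fun s : Finset (Fin n) => s.card = k) (F := inferInstance) _ (by simp)]
  simp_rw [kneserGraph_mulVec_apply hk]

/-- Every eigenvalue of `K(n,k)` is of the form `(-1)^j * C(n-k-j, k-j)`. -/
theorem kneserGraph_eigenvalue (hk : 1 ≤ k) (i : {s : Finset (Fin n) // s.card = k}) :
    ∃ j ≤ k, (kneserGraph n k).adjEigenvalue i = (-1) ^ j * ((n - k - j).choose (k - j) : ℝ) := by
  obtain ⟨y, hy, h⟩ := (kneserGraph n k).exists_eigenvector_adjEigenvalue i
  obtain ⟨S, hS⟩ := Function.ne_iff.1 hy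
  -- By minimality of `J`, inclusion–exclusion for `disjSum y J` keeps only the term `I = J`.
  -- Summing `A y = λ y` over the supersets of `J` then determines `λ`.
  obtain ⟨J, hJ, hmin⟩ := Finset.exists_min_image
    (Finset.univ.filter fun J => supSum y J ≠ 0) Finset.card
    ⟨S.1, by simpa [supSum_self] using hS⟩
  have hJ0 : supSum y J ≠ 0 := by simpa using hJ
  have hJk : J.card ≤ k := (hmin S.1 (by simpa [supSum_self] using hS)).trans S.2.le
  have hlow : ∀ I, I.card < J.card → supSum y I = 0 := fun I hI => by
    by_contra hne
    exact absurd (hmin I (by simpa using hne)) (by omega)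
  have hdisj : disjSum y J = (-1) ^ J.card * supSum y J := by
    rw [disjSum_eq_sum_supSum, Finset.sum_eq_single_of_mem J (by simp)]
    intro I hI hne
    rw [hlow I (Finset.card_lt_card (Finset.ssubset_iff_subset_ne.2
      ⟨Finset.mem_powerset.1 hI, hne⟩)), mul_zero]
  have hsup := supSum_kneserGraph_mulVec hk y hJk
  rw [h, hdisj] at hsup
  refine ⟨J.card, hJk, mul_right_cancel₀ hJ0 ?_⟩
  have hs : supSum ((kneserGraph n k).adjEigenvalue i • y) J =
      (kneserGraph n k).adjEigenvalue i * supSum y J := by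
    simp [supSum, Finset.mul_sum]
  rw [← hs, hsup]
  ring

lemma kneserGraph_eigenvalue_ne_zero (hk : 1 ≤ k) (hn : 2 * k < n)
    (i : {s : Finset (Fin n) // s.card = k}) : (kneserGraph n k).adjEigenvalue i ≠ 0 := by
  obtain ⟨j, hj, h⟩ := kneserGraph_eigenvalue hk i
  rw [h]
  have := Nat.choose_pos (by omega : k - j ≤ n - k - j)
  positivity

lemma kneserGraph_nonempty (hn : 2 * k < n) : Nonempty {s : Finset (Fin n) // s.card = k} := by
  rw [← Fintype.card_pos_iff, card_kneserGraph_vertex]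
  exact Nat.choose_pos (by omega)

lemma kneserGraph_maxAdjEigenvalue (hk : 1 ≤ k) (hn : 2 * k < n) :
    (kneserGraph n k).maxAdjEigenvalue = (n - k).choose k := by
  have := kneserGraph_nonempty hn
  refine le_antisymm (ciSup_le fun i => ?_) ?_
  · obtain ⟨j, hj, h⟩ := kneserGraph_eigenvalue hk i
    rw [h]
    have h1 : ((n - k - j).choose (k - j) : ℝ) ≤ (n - k).choose k := by
      exact_mod_cast choose_sub_sub_le_choose j hj (by omega)
    have h2 : (0 : ℝ) ≤ (n - k - j).choose (k - j) := by positivity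
    rcases neg_one_pow_eq_or ℝ j with e | e <;> rw [e] <;> linarith
  · obtain ⟨i, hi⟩ := (kneserGraph n k).exists_adjEigenvalue_eq (x := fun _ => 1)
      (μ := (n - k).choose k) (fun h => by simpa using congrFun h (Classical.arbitrary _)) (by
        ext S
        simp [adjMatrix_mulVec_apply, (kneserGraph_isRegularOfDegree hk).degree_eq S])
    exact hi ▸ adjEigenvalue_le_max _ i

/-- The image is a constant multiple of the indicator of the star's complement, so a difference of
two star indicators is an eigenvector. -/
lemma kneserGraph_mulVec_star (hk : 1 ≤ k) (a : Fin n) (S : {s : Finset (Fin n) // s.card = k}) :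
    ((kneserGraph n k).adjMatrix ℝ *ᵥ fun T => if a ∈ T.1 then (1 : ℝ) else 0) S =
      if a ∈ S.1 then 0 else ((n - k - 1).choose (k - 1) : ℝ) := by
  have := card_powersetCard_filter_subset_disjoint (X := Finset.univ) (J := {a}) (m := k) S.1
    (Finset.subset_univ _) (by simpa)
  rw [← card_kneserGraph_filter fun T => {a} ⊆ T ∧ Disjoint T S.1] at this
  rw [kneserGraph_mulVec_apply hk, disjSum]
  simp_rw [← ite_and]
  rw [Finset.sum_boole]
  simp only [Finset.singleton_subset_iff, Finset.card_univ_sdiff, S.2, Fintype.card_fin,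
    Finset.disjoint_singleton_left, Finset.card_singleton] at this
  simp_rw [disjoint_comm (a := S.1), and_comm (b := a ∈ _)]
  rw [this]
  split_ifs <;> simp_all

lemma kneserGraph_minAdjEigenvalue (hk : 1 ≤ k) (hn : 2 * k < n) :
    (kneserGraph n k).minAdjEigenvalue = -((n - k - 1).choose (k - 1) : ℝ) := by
  have := kneserGraph_nonempty hn
  refine le_antisymm ?_ (le_ciInf fun i => ?_)
  · let a : Fin n := ⟨0, by omega⟩
    let b : Fin n := ⟨1, by omega⟩
    have hab : a ≠ b := by simp [a, b]
    obtain ⟨S, haS, hSb, hS⟩ := Finset.exists_subsuperset_card_eq (s := {a}) (t := {b}ᶜ) (n := k)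
      (by simpa using hab.symm) (by simpa) (by simp [Finset.card_compl]; omega)
    obtain ⟨i, hi⟩ := (kneserGraph n k).exists_adjEigenvalue_eq
      (x := (fun T => if a ∈ T.1 then (1 : ℝ) else 0) - fun T => if b ∈ T.1 then (1 : ℝ) else 0)
      (μ := -((n - k - 1).choose (k - 1) : ℝ)) (fun h => by
        have hb : b ∉ S := fun hb => by simpa using hSb hb
        have := congrFun h ⟨S, hS⟩
        simp [Finset.singleton_subset_iff.1 haS, hb] at this) (by
        ext T
        rw [mulVec_sub, Pi.sub_apply, kneserGraph_mulVec_star hk, kneserGraph_mulVec_star hk]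
        simp only [Pi.smul_apply, Pi.sub_apply, smul_eq_mul]
        split_ifs <;> ring)
    exact hi ▸ min_le_adjEigenvalue _ i
  · obtain ⟨j, hj, h⟩ := kneserGraph_eigenvalue hk i
    rw [h]
    rcases Nat.even_or_odd j with e | e
    · rw [e.neg_one_pow]
      have h2 : (0 : ℝ) ≤ (n - k - j).choose (k - j) := by positivity
      have h3 : (0 : ℝ) ≤ (n - k - 1).choose (k - 1) := by positivity
      linarith
    · rw [e.neg_one_pow, neg_one_mul, neg_le_neg_iff]
      have := e.pos
      -- Odd `j` is at least `1`, so the comparison starts from `j = 1`.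
      have h1 := choose_sub_sub_le_choose (a := n - k - 1) (b := k - 1) (j - 1) (by omega)
        (by omega)
      rw [show n - k - 1 - (j - 1) = n - k - j by omega,
        show k - 1 - (j - 1) = k - j by omega] at h1
      exact_mod_cast h1

/-! ### Upper estimate of the inertia bound; the ratio bound. -/

/-- If `y` vanishes on the star of `a` and `A y` vanishes on that star, then `A` acts on `y` as
`(-1)^k` off the star. -/
lemma kneserGraph_mulVec_of_eq_zero_on_star (hk : 1 ≤ k) (hn : 2 * k < n) (a : Fin n)
    {y : {s : Finset (Fin n) // s.card = k} → ℝ} (hy : ∀ S, a ∈ S.1 → y S = 0)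
    (hAy : ∀ S, a ∈ S.1 → ((kneserGraph n k).adjMatrix ℝ *ᵥ y) S = 0)
    {S : {s : Finset (Fin n) // s.card = k}} (hS : a ∉ S.1) :
    ((kneserGraph n k).adjMatrix ℝ *ᵥ y) S = (-1) ^ k * y S := by
  set X : Finset (Fin n) := Finset.univ.erase a
  -- Adjoining `a` to `R` gives a vertex of the star, and disjointness is unaffected because the
  -- support of `y` avoids `a`.
  have hR : ∀ R ∈ X.powersetCard (k - 1), disjSum y R = 0 := fun R hR => by
    rw [Finset.mem_powersetCard] at hR
    have haR : a ∉ R := fun h => Finset.notMem_erase a _ (hR.1 h)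
    have hc : (insert a R).card = k := by
      rw [Finset.card_insert_of_notMem haR, hR.2]; omega
    have := hAy ⟨insert a R, hc⟩ (Finset.mem_insert_self a R)
    rw [kneserGraph_mulVec_apply hk] at this
    rw [← this]
    refine Finset.sum_congr rfl fun T _ => ?_
    by_cases haT : a ∈ T.1
    · simp [hy T haT]
    · simp [Finset.disjoint_insert_left, haT]
  -- Double counting inside `X` passes from `(k-1)`-sets to smaller ones; `n > 2k` makes the
  -- coefficient non-zero.
  have hdisj : ∀ J ⊆ X, J.card ≤ k - 1 → disjSum y J = 0 := fun J hJ hJk => by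
    have h := sum_disjSum_of_subset y hJ hJk (c := n - 1 - k) fun T hT => by
      have haT : a ∉ T.1 := fun h => hT (hy T h)
      rw [Finset.card_sdiff_of_subset fun x hx => by
        simp only [X, Finset.mem_erase, Finset.mem_univ, and_true]
        rintro rfl
        exact haT hx, T.2, Finset.card_erase_of_mem (Finset.mem_univ a), Finset.card_univ,
        Fintype.card_fin]
    rw [Finset.sum_eq_zero fun R hR' => by rw [hR R hR', ite_self]] at h
    have hpos := Nat.choose_pos (by omega : k - 1 - J.card ≤ n - 1 - k - J.card)
    exact (mul_eq_zero.1 h.symm).resolve_left (by positivity)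
  have hSX : S.1 ⊆ X := fun x hx => by
    simp only [X, Finset.mem_erase, Finset.mem_univ, and_true]
    rintro rfl
    exact hS hx
  -- All proper subsets of `S` contribute zero to the inversion formula.
  have hsup : y S = (-1) ^ k * disjSum y S.1 := by
    rw [← supSum_self y S, supSum_eq_sum_disjSum, Finset.sum_eq_single_of_mem S.1 (by simp), S.2]
    intro I hI hne
    rw [Finset.mem_powerset] at hI
    have := Finset.card_lt_card (Finset.ssubset_iff_subset_ne.2 ⟨hI, hne⟩)
    rw [S.2] at this
    rw [hdisj I (hI.trans hSX) (by omega), mul_zero]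
  rw [kneserGraph_mulVec_apply hk, hsup, ← mul_assoc, ← mul_pow]
  simp

/-- Split `x = e + y` along the star. All terms involving `e` vanish, and `yᵀAy = (-1)^k yᵀy`. -/
lemma kneserGraph_quadraticForm_nonneg (hk : 1 ≤ k) (hn : 2 * k < n) (a : Fin n)
    {x : {s : Finset (Fin n) // s.card = k} → ℝ}
    (hx : ∀ S, a ∈ S.1 → ((kneserGraph n k).adjMatrix ℝ *ᵥ x) S = 0) :
    0 ≤ (-1) ^ k * (x ⬝ᵥ (kneserGraph n k).adjMatrix ℝ *ᵥ x) := by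
  set A := (kneserGraph n k).adjMatrix ℝ
  set e : {s : Finset (Fin n) // s.card = k} → ℝ := fun S => if a ∈ S.1 then x S else 0 with he
  set y : {s : Finset (Fin n) // s.card = k} → ℝ := fun S => if a ∈ S.1 then 0 else x S with hy
  have hxy : x = e + y := by
    ext S
    simp only [he, hy, Pi.add_apply]
    split_ifs <;> simp
  have hAe : ∀ S, a ∈ S.1 → (A *ᵥ e) S = 0 := fun S hS => by
    rw [kneserGraph_mulVec_apply hk]
    refine Finset.sum_eq_zero fun T _ => ?_
    split_ifs with h
    · exact if_neg (Finset.disjoint_left.1 h hS)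
    · rfl
  have hAy : ∀ S, a ∈ S.1 → (A *ᵥ y) S = 0 := fun S hS => by
    have := hx S hS
    rwa [hxy, mulVec_add, Pi.add_apply, hAe S hS, zero_add] at this
  have hee : e ⬝ᵥ A *ᵥ e = 0 := Finset.sum_eq_zero fun S _ => by
    by_cases hS : a ∈ S.1
    · rw [hAe S hS, mul_zero]
    · simp [he, hS]
  have hey : e ⬝ᵥ A *ᵥ y = 0 := Finset.sum_eq_zero fun S _ => by
    by_cases hS : a ∈ S.1
    · rw [hAy S hS, mul_zero]
    · simp [he, hS]
  have hye : y ⬝ᵥ A *ᵥ e = 0 := by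
    rw [dotProduct_mulVec, ← mulVec_transpose, transpose_adjMatrix, dotProduct_comm, hey]
  have hyy : y ⬝ᵥ A *ᵥ y = (-1) ^ k * (y ⬝ᵥ y) := by
    rw [dotProduct, dotProduct, Finset.mul_sum]
    refine Finset.sum_congr rfl fun S _ => ?_
    by_cases hS : a ∈ S.1
    · simp [hy, hS]
    · rw [kneserGraph_mulVec_of_eq_zero_on_star hk hn a (fun S hS => if_pos hS) hAy hS]
      ring
  rw [hxy, mulVec_add, dotProduct_add, add_dotProduct, add_dotProduct, hee, hey, hye, hyy,
    zero_add, zero_add, zero_add, ← mul_assoc, ← mul_pow]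
  simpa using dotProduct_self_star_nonneg y

lemma kneserGraph_inertiaBound_le (hk : 1 ≤ k) (hn : 2 * k < n) :
    (kneserGraph n k).inertiaBound ≤ (n - 1).choose (k - 1) := by
  let a : Fin n := ⟨0, by omega⟩
  have hcard : Fintype.card {S : {s : Finset (Fin n) // s.card = k} // a ∈ S.1} =
      (n - 1).choose (k - 1) := by
    rw [Fintype.card_subtype, ← card_kneserStar hk a, kneserStar]
  have key := ((kneserGraph n k).isHermitian_adjMatrix (R := ℝ)).card_le_of_nonneg_on_ker
    (W := {S : {s : Finset (Fin n) // s.card = k} // a ∈ S.1})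
    (LinearMap.funLeft ℝ ℝ Subtype.val ∘ₗ ((kneserGraph n k).adjMatrix ℝ).mulVecLin) ((-1) ^ k)
    (Finset.univ.filter fun i => (-1) ^ k * (kneserGraph n k).adjEigenvalue i < 0)
    (fun i hi => (Finset.mem_filter.1 hi).2)
    (fun x hx => kneserGraph_quadraticForm_nonneg hk hn a fun S hS => congrFun hx ⟨S, hS⟩)
  rw [hcard] at key
  refine le_trans ?_ key
  -- Parity selects the entry of the minimum; non-singularity makes its inequality strict.
  rcases Nat.even_or_odd k with e | e
  · refine (min_le_right _ _).trans (Finset.card_le_card fun i hi => ?_)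
    rw [Finset.mem_filter] at hi ⊢
    rw [e.neg_one_pow, one_mul]
    exact ⟨hi.1, lt_of_le_of_ne hi.2 (kneserGraph_eigenvalue_ne_zero hk hn i)⟩
  · refine (min_le_left _ _).trans (Finset.card_le_card fun i hi => ?_)
    rw [Finset.mem_filter] at hi ⊢
    rw [e.neg_one_pow, neg_one_mul, neg_lt_zero]
    exact ⟨hi.1, lt_of_le_of_ne hi.2 (kneserGraph_eigenvalue_ne_zero hk hn i).symm⟩

lemma kneserGraph_inertiaBound_and_indepNum (hk : 1 ≤ k) (hn : 2 * k < n) :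
    (kneserGraph n k).inertiaBound = (n - 1).choose (k - 1) ∧
      (kneserGraph n k).indepNum = (n - 1).choose (k - 1) := by
  have h1 := kneserGraph_inertiaBound_le hk hn
  obtain ⟨s, hs⟩ := (kneserGraph n k).exists_isNIndepSet_indepNum
  have h2 := hs.isIndepSet.card_le_inertiaBound
  rw [hs.card_eq] at h2
  have h3 := (isIndepSet_kneserStar (k := k) (⟨0, by omega⟩ : Fin n)).card_le_indepNum
  rw [card_kneserStar hk] at h3
  omega

/-- Absorption, `(a + 1) C(a,b) = (b + 1) C(a+1,b+1)`, is applied to both the vertex count and the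
degree. -/
lemma kneserGraph_ratioBound (hk : 1 ≤ k) (hn : 2 * k < n) :
    (kneserGraph n k).ratioBound = ((n - 1).choose (k - 1) : ℝ) := by
  rw [ratioBound, kneserGraph_maxAdjEigenvalue hk hn, kneserGraph_minAdjEigenvalue hk hn,
    card_kneserGraph_vertex]
  obtain ⟨l, rfl⟩ : ∃ l, k = l + 1 := ⟨k - 1, by omega⟩
  obtain ⟨m, rfl⟩ : ∃ m, n = m + 1 + (l + 1) := ⟨n - 1 - (l + 1), by omega⟩
  have e1 : m + 1 + (l + 1) - (l + 1) = m + 1 := by omega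
  have e2 : m + 1 + (l + 1) - 1 = m + 1 + l := by omega
  rw [e1, e2, Nat.add_sub_cancel, Nat.add_sub_cancel]
  have h1 : ((m + 1 + l + 1 : ℕ) : ℝ) * (m + 1 + l).choose l =
      (m + 1 + (l + 1)).choose (l + 1) * ((l + 1 : ℕ) : ℝ) := by
    exact_mod_cast Nat.add_one_mul_choose_eq (m + 1 + l) l
  have h2 : ((m + 1 : ℕ) : ℝ) * m.choose l = (m + 1).choose (l + 1) * ((l + 1 : ℕ) : ℝ) := by
    exact_mod_cast Nat.add_one_mul_choose_eq m l
  have hμ : (0 : ℝ) < m.choose l := by exact_mod_cast Nat.choose_pos (by omega)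
  have hd : (0 : ℝ) ≤ (m + 1).choose (l + 1) := by positivity
  push_cast at h1 h2
  have hl : (l : ℝ) + 1 ≠ 0 := by positivity
  rw [div_neg, sub_neg_eq_add, div_eq_iff (by positivity), one_add_div hμ.ne', mul_div_assoc',
    eq_div_iff hμ.ne']
  refine mul_right_cancel₀ hl ?_
  linear_combination (-(m.choose l : ℝ)) * h1 + ((m + 1 + l).choose l : ℝ) * h2

/-! ### Connectedness. -/

lemma kneserGraph_reachable_exchange (hk : 1 ≤ k) (hn : 2 * k < n)
    {S T : {s : Finset (Fin n) // s.card = k}} {b : Fin n} (h : T.1 ⊆ insert b S.1) :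
    (kneserGraph n k).Reachable S T := by
  -- The complement has at least `n - (k + 1) ≥ k` points, enough for a common neighbour of `S` and
  -- `T`.
  have hc : k ≤ (insert b S.1)ᶜ.card := by
    have := Finset.card_insert_le b S.1
    rw [Finset.card_compl, Fintype.card_fin]
    rw [S.2] at this
    omega
  obtain ⟨R, hR, hRk⟩ := Finset.exists_subset_card_eq hc
  have hd : Disjoint (insert b S.1) R :=
    Finset.disjoint_of_subset_right hR disjoint_compl_right
  have h1 : (kneserGraph n k).Adj S ⟨R, hRk⟩ :=
    (kneserGraph_adj_iff hk).2 (hd.mono_left (Finset.subset_insert b S.1))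
  have h2 : (kneserGraph n k).Adj T ⟨R, hRk⟩ := (kneserGraph_adj_iff hk).2 (hd.mono_left h)
  exact h1.reachable.trans h2.symm.reachable

lemma kneserGraph_connected (hk : 1 ≤ k) (hn : 2 * k < n) : (kneserGraph n k).Connected := by
  have := kneserGraph_nonempty hn
  refine ⟨fun S T => ?_⟩
  induction hm : (S.1 \ T.1).card generalizing S with
  | zero =>
    rw [Finset.card_eq_zero, Finset.sdiff_eq_empty_iff_subset] at hm
    obtain rfl : S = T := Subtype.ext (Finset.eq_of_subset_of_card_le hm (by rw [S.2, T.2]))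
    exact Reachable.rfl
  | succ m ih =>
    have hTS : (T.1 \ S.1).card = m + 1 := by
      rw [← hm, Finset.card_sdiff_comm (by rw [S.2, T.2])]
    obtain ⟨a, ha⟩ := Finset.card_pos.1 (by omega : 0 < (S.1 \ T.1).card)
    obtain ⟨b, hb⟩ := Finset.card_pos.1 (by omega : 0 < (T.1 \ S.1).card)
    rw [Finset.mem_sdiff] at ha hb
    have hU : (insert b (S.1.erase a)).card = k := by
      rw [Finset.card_insert_of_notMem fun h => hb.2 (Finset.mem_of_mem_erase h),
        Finset.card_erase_of_mem ha.1, S.2]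
      omega
    refine (kneserGraph_reachable_exchange hk hn (T := ⟨_, hU⟩)
      (Finset.insert_subset_insert b (Finset.erase_subset a S.1))).trans (ih _ ?_)
    have : insert b (S.1.erase a) \ T.1 = (S.1 \ T.1).erase a := by
      rw [Finset.insert_sdiff_of_mem _ hb.1, Finset.erase_sdiff_comm]
    simp only [this]
    rw [Finset.card_erase_of_mem (Finset.mem_sdiff.2 ha), hm, Nat.add_sub_cancel]

end Kneser

end SimpleGraph

theorem corollary3p4 (n k : ℕ) (hk : 1 ≤ k) (hn : 2 * k < n) :
    (SimpleGraph.kneserGraph n k).IsTightCvetkovicHoffman 1 ∧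
    (SimpleGraph.kneserGraph n k).inertiaBound = (n - 1).choose (k - 1) ∧
    (SimpleGraph.kneserGraph n k).ratioBound = ((n - 1).choose (k - 1) : ℝ) ∧
    (SimpleGraph.kneserGraph n k).indepNum = (n - 1).choose (k - 1) := by
  obtain ⟨hi, hα⟩ := SimpleGraph.kneserGraph_inertiaBound_and_indepNum hk hn
  have hr := SimpleGraph.kneserGraph_ratioBound hk hn
  refine ⟨SimpleGraph.isTightCvetkovicHoffman_one _ ?_ ?_ (SimpleGraph.kneserGraph_connected hk hn)
    ⟨_, SimpleGraph.kneserGraph_isRegularOfDegree hk⟩ ?_ (hi.trans hα.symm) (by rw [hr, hα]),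
    hi, hr, hα⟩
  · rw [SimpleGraph.kneserGraph_maxAdjEigenvalue hk hn]
    exact_mod_cast Nat.choose_pos (by omega)
  · rw [SimpleGraph.kneserGraph_minAdjEigenvalue hk hn, neg_lt_zero]
    exact_mod_cast Nat.choose_pos (by omega)
  · rw [hi, SimpleGraph.card_kneserGraph_vertex]
    obtain ⟨l, rfl⟩ : ∃ l, k = l + 1 := ⟨k - 1, by omega⟩
    obtain ⟨m, rfl⟩ : ∃ m, n = m + 1 := ⟨n - 1, by omega⟩
    have := Nat.choose_pos (by omega : l + 1 ≤ m)
    -- Pascal's rule: the other summand `C(n-1,k)` is positive, so the inertia bound is below the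
    -- vertex count.
    rw [Nat.choose_succ_succ']
    simp only [Nat.add_sub_cancel]
    omega
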